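/- **Setting.** Let $\Gamma$ be the set of dyadic rationals $a=p/2^{l}\in(0,1)$ with $p$ odd; $l=l(a)$ is called the level of $a$. Let the planar dendrite $D_\infty\subset\mathbb R^2$ be built as follows (this is the star-by-star construction of Ważewski's universal dendrite, with one explicit choice of the stars). For $n\ge 0$ let $L_n:\mathbb R^2\to\mathbb R^2$ be the linear map $$L_0(x,y)=(-x,-y),\qquad L_1(x,y)=(-y,x),\qquad L_n(x,y)=2^{-n}\bigl(x,\,4^{-n}(x+y)\bigr)\quad(n\ge 2),$$ and for $a\in\Gamma$ and $m\ge 0$ let $$F_{a,m}(x,y)=(a,0)+2^{-(l(a)+1+m)}\bigl(4^{-m}(x-\tfrac y2),\,x\bigr).$$ For $n_1,\dots,n_k\ge 0$, $a_1,\dots,a_{k-1}\in\Gamma$ and $r\in[0,1]$, where $k\ge 1$, put $$P(n_1,a_1,n_2,a_2,\dots,n_k,r)=L_{n_1}\circ F_{a_1,n_2}\circ F_{a_2,n_3}\circ\cdots\circ F_{a_{k-1},n_k}(r,0).$$ For fixed $(n_1,a_1,\dots,n_k)$ the points with $r\in[0,1]$ form a segment, called a beam, on which $r$ measures the proportion of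 its length from its initial point. The beams $B_n=\{P(n,r):0\le r\le 1\}$, $n\geq 0$, form a star with center the origin $\mathbf 0$, and for $a_k\in\Gamma$ the beams with labels $(n_1,a_1,\dots,n_k,a_k,m)$, $m\ge 0$, form a star with center $P(n_1,a_1,\dots,n_k,a_k)$. Let $X_k$ be the union of the beams with labels $(n_1,a_1,\dots,n_i)$, $1\le i\le k$, and let $D_\infty=\overline{\bigcup_{k\ge1}X_k}$. Let $2^{D_\infty}$ be the space of non-empty closed subsets of $D_\infty$ with the Hausdorff metric. For a map $f:D_\infty\to D_\infty$ let $\omega(x,f)=\bigcap_{n\ge 1}\overline{\{f^k(x):k\ge n\}}$, and let $\omega(f)=\{A\in 2^{D_\infty}: A=\omega(x,f)\text{ for some }x\in D_\infty\}$, as a subspace of $2^{D_\infty}$. For $r\in[0,1]$ let $$D_r=\bigcup_{j\ge0}\{P(j,t):0\le t\le r\}$$ be the union of the initial segments of proportion $r$ of the beams at the origin (so $D_0=\{\mathbf 0\}$). **Proposition.** There is exactly one continuous map $f:D_\infty\to D_\infty$ with $f(\mathbf 0)=\mathbf 0$ which acts on the points $P(n_1,a_1,\dots,n_k,r)$, $0<r\le1$,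 by $$(0,r)\mapsto \mathbf 0,\qquad (n_1,a_1,n_2,\dots,n_k,r)\mapsto(n_1-1,a_1,n_2,\dots,n_k,r)\ \text{ if } n_1\ge1,$$ $$(0,a_1,n_2,a_2,\dots,n_k,r)\mapsto(n_2+l(a_1),a_2,\dots,n_k,r)\ \text{ if } k\ge 2 .$$ For this map $f$: 1. for each $r\in(0,1]$ there is a point $x\in D_\infty$ with $\omega(x,f)=D_r$; 2. $r\mapsto D_r$ is a homeomorphism from $[0,1]$ onto its image in $2^{D_\infty}$, and this arc $\{D_r:0\le r\le1\}$ is contained in $\omega(f)$; 3. consequently $\omega(f)$ is not totally disconnected: it contains a connected subset with more than one point, and it is also not true that any two distinct points of $\omega(f)$ can be separated by a partition of $\omega(f)$ into two open sets. -/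

import Mathlib

open Set Filter Topology TopologicalSpace

/-- The Euclidean plane. -/
abbrev Plane : Type := EuclideanSpace ℝ (Fin 2)

/-- The dyadic rationals of the open interval `(0, 1)`, in lowest terms: `num / 2 ^ level` with
`num` odd (so `1 ≤ level`). -/
structure DyadicPt where
  num : ℕ
  level : ℕ
  num_odd : Odd num
  num_lt : num < 2 ^ level

noncomputable section

def DyadicPt.val (a : DyadicPt) : ℝ := (a.num : ℝ) / 2 ^ a.level

/-- The linear map that carries the unit segment `[0, 1] × {0}` onto the `n`-th beam `B n` of the
star at the origin. So `B 0 = [-1, 0] × {0}`, `B 1 = {0} × [0, 1]`, and for `2 ≤ n` the beam `B n`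
goes from the origin to `2 ^ (-n) • (1, 4 ^ (-n))`, inside the first quadrant, with slope
`4 ^ (-n)`. The triangle `0 ≤ y ≤ x ≤ 1` is carried to triangles that meet only at the origin. -/
def rootMap : ℕ → Plane → Plane
  | 0, p => !₂[-p 0, -p 1]
  | 1, p => !₂[-p 1, p 0]
  | n + 2, p => (1 / 2 : ℝ) ^ (n + 2) • !₂[p 0, (1 / 4 : ℝ) ^ (n + 2) * (p 0 + p 1)]

/-- The affine map that carries the unit segment `[0, 1] × {0}` onto the `m`-th beam of the star
attached to that segment at `(a, 0)`; this beam goes from `(a, 0)` to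
`(a, 0) + 2 ^ (-(l + 1 + m)) • (4 ^ (-m), 1)`, where `l` is the level of `a`.
The triangle `0 ≤ y ≤ x ≤ 1` is carried into itself; its images for different `a` are disjoint,
and for the same `a` they meet only at `(a, 0)`. -/
def attachMap (a : DyadicPt) (m : ℕ) (p : Plane) : Plane :=
  !₂[a.val, 0] +
    (1 / 2 : ℝ) ^ (a.level + 1 + m) • !₂[(1 / 4 : ℝ) ^ m * (p 0 - p 1 / 2), p 0]

/-- Position, relative to a unit segment, of the point that is reached by moving to `a₁`, entering
the `n₂`-th beam of the star attached there, moving to proportion `a₂`, ..., and finally moving to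
proportion `r` of the last beam entered. -/
def localPt : List (DyadicPt × ℕ) → ℝ → Plane
  | [], r => !₂[r, 0]
  | (a, m) :: τ, r => attachMap a m (localPt τ r)

/-- The point with itinerary `(n₁, a₁, n₂, a₂, …, nₖ, r)`, where
`τ = [(a₁, n₂), (a₂, n₃), …, (aₖ₋₁, nₖ)]`. -/
def itinPt (n : ℕ) (τ : List (DyadicPt × ℕ)) (r : ℝ) : Plane :=
  rootMap n (localPt τ r)

/-- The beams: `beam n []` is the `n`-th beam of the star at the origin, and
`beam n (τ ++ [(a, m)])` is the `m`-th beam of the star whose center is the point `itinPt n τ a`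
at proportion `a` of the beam `beam n τ`. -/
def beam (n : ℕ) (τ : List (DyadicPt × ℕ)) : Set Plane :=
  itinPt n τ '' Icc 0 1

/-- `stage 1` is the star at the origin; `stage (k + 1)` is `stage k` together with the stars
attached at the dyadic points of the beams that were added last. -/
def stage (k : ℕ) : Set Plane :=
  ⋃ (n : ℕ) (τ : List (DyadicPt × ℕ)) (_ : τ.length < k), beam n τ

/-- The universal dendrite, as the closure of the union of the stages. -/
def Dinf : Set Plane := closure (⋃ k : ℕ, stage k)

/-- The prescribed action on finite itineraries (`0 < r ≤ 1`):
the origin is fixed, `(0, r) ↦ origin`, `(n + 1, …) ↦ (n, …)`, and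
`(0, a, m, …) ↦ (m + l, …)` where `l` is the level of `a`. -/
structure ActsOnItineraries (f : Dinf → Dinf) : Prop where
  origin : ∀ x : Dinf, (x : Plane) = 0 → (f x : Plane) = 0
  base : ∀ r ∈ Ioc (0 : ℝ) 1, ∀ x : Dinf, (x : Plane) = itinPt 0 [] r → (f x : Plane) = 0
  pred : ∀ (n : ℕ) (τ : List (DyadicPt × ℕ)), ∀ r ∈ Ioc (0 : ℝ) 1, ∀ x : Dinf,
    (x : Plane) = itinPt (n + 1) τ r → (f x : Plane) = itinPt n τ r
  drop : ∀ (a : DyadicPt) (m : ℕ) (τ : List (DyadicPt × ℕ)), ∀ r ∈ Ioc (0 : ℝ) 1, ∀ x : Dinf,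
    (x : Plane) = itinPt 0 ((a, m) :: τ) r → (f x : Plane) = itinPt (m + a.level) τ r

/-- The omega limit set of the point `x` under iteration of `f`. -/
def omegaSet {X : Type*} [TopologicalSpace X] (f : X → X) (x : X) : Set X :=
  omegaLimit atTop (fun (k : ℕ) (y : X) => f^[k] y) {x}

/-- The hyperspace of omega limit sets of `f`, inside the hyperspace of nonempty compact subsets
with the topology of the Hausdorff metric. -/
def omegaHyperspace {X : Type*} [TopologicalSpace X] (f : X → X) : Set (NonemptyCompacts X) :=
  {A | ∃ x : X, (A : Set X) = omegaSet f x}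

/-- The union of the initial segments of proportion `r` of the beams at the origin. -/
def initialSegments (r : ℝ) : Set Dinf :=
  {x | ∃ j : ℕ, ∃ t ∈ Icc (0 : ℝ) r, (x : Plane) = itinPt j [] t}

end

/-! The dendrite is self-similar. It is the union of the root copies of one compact set
`localDendrite`, which itself is a unit segment together with its images under all `attachMap a m`
(`localDendrite_eq`). Distinct copies meet only at star centers (`rootMap_eq_rootMap`,
`attachMap_eq_attachMap`), and their sizes tend to zero.

The rule for `f` therefore makes sense on whole copies, not only on finite itineraries; this is
`ShiftRel`. It is single-valued because overlaps of copies are centers, where all the candidate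
values are the origin. Its graph is compact because the pieces of the graph shrink to the piece over
the beam 0, so the map is continuous. It is the only such map because the points with finite
itineraries are dense.

For `0 < r ≤ 1`, list the dyadics below `r` as `a 0, a 1, …`, each infinitely often, and take the
point with infinite itinerary `(0, a 0, 0, a 1, 1, a 2, 2, …)`. Its tails `p k = attachPt (a k) k (p
(k + 1))` exist by compactness. The orbit carries `p (k + 1)` down through the root beams `k +
level, …, 1, 0` and then passes to `p (k + 2)`. Since `p k` lies in the `k`-th beam copy at `a k`,
it is `2 ^ (-k)`-close to `a k`. Hence the cluster points are the closure of the points at dyadic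
proportions below `r` on all root beams, which is `initialSegments r`.

Cutting initial segments at `r` is Lipschitz in `r` and injective, hence an embedding of the compact
interval. The value at 0 is the limit set of the fixed origin, so the limit sets contain a
nondegenerate connected set. -/

/-! ### General topology -/

/-- A compact set together with a family of compact sets that shrink towards it is compact. -/
theorem IsCompact.union_iUnion_of_tendsto {X ι : Type*} [PseudoMetricSpace X] {C : Set X}
    {K : ι → Set X} {d : ι → ℝ} (hC : IsCompact C) (hK : ∀ i, IsCompact (K i))
    (hd : Tendsto d cofinite (𝓝 0)) (h : ∀ i, ∀ x ∈ K i, ∃ c ∈ C, dist x c ≤ d i) :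
    IsCompact (C ∪ ⋃ i, K i) := by
  classical
  refine isCompact_of_finite_subcover fun {κ} U hU hcov => ?_
  -- A finite subcover of `C` already covers a `δ`-thickening of `C`, which contains all but
  -- finitely many `K i`; the remaining ones form a compact set.
  obtain ⟨t, ht⟩ := hC.elim_finite_subcover U hU (subset_union_left.trans hcov)
  obtain ⟨δ, hδ, hδU⟩ :=
    hC.exists_thickening_subset_open (isOpen_biUnion fun i (_ : i ∈ t) => hU i) ht
  have hfin : {i | ¬ d i < δ}.Finite := hd.eventually (gt_mem_nhds hδ)
  have hcomp : IsCompact (⋃ i ∈ {i | ¬ d i < δ}, K i) :=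
    hfin.isCompact_biUnion fun i _ => hK i
  obtain ⟨s, hs⟩ := hcomp.elim_finite_subcover U hU
    ((iUnion₂_subset fun i _ => subset_iUnion K i).trans (subset_union_right.trans hcov))
  refine ⟨t ∪ s, ?_⟩
  rw [Finset.set_biUnion_union]
  rintro x (hx | hx)
  · exact Or.inl (ht hx)
  · obtain ⟨i, hi⟩ := mem_iUnion.1 hx
    by_cases hdi : d i < δ
    · obtain ⟨c, hc, hxc⟩ := h i x hi
      exact Or.inl (hδU (Metric.mem_thickening_iff.2 ⟨c, hc, hxc.trans_lt hdi⟩))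
    · exact Or.inr (hs (mem_biUnion (show i ∈ {i | ¬ d i < δ} from hdi) hi))

/-- The preimage of a closed `C` is the projection of the part of the graph over `C`, and projection
along a compact factor is a closed map. -/
theorem continuous_of_isClosed_graph_of_compactSpace {X Y : Type*} [TopologicalSpace X]
    [TopologicalSpace Y] [CompactSpace Y] {f : X → Y} (h : IsClosed {z : X × Y | f z.1 = z.2}) :
    Continuous f := by
  refine continuous_iff_isClosed.2 fun C hC => ?_
  have : f ⁻¹' C = Prod.fst '' ({z : X × Y | f z.1 = z.2} ∩ Prod.snd ⁻¹' C) := by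
    ext x
    constructor
    · exact fun hx => ⟨(x, f x), ⟨rfl, hx⟩, rfl⟩
    · rintro ⟨⟨y, z⟩, ⟨hyz, hz⟩, rfl⟩
      exact mem_preimage.2 (Eq.symm hyz ▸ hz)
  rw [this]
  exact isClosedMap_fst_of_compactSpace _ (h.inter (hC.preimage continuous_snd))

/-- Every sequence of continuous self-maps of a compact space has a backward orbit. -/
theorem exists_backward_orbit {X : Type*} [TopologicalSpace X] [CompactSpace X] [T2Space X]
    [Nonempty X] (F : ℕ → X → X) (hF : ∀ k, Continuous (F k)) :
    ∃ p : ℕ → X, ∀ k, p k = F k (p (k + 1)) := by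
  -- Chains of finite length always exist; quantifying over `F` lets the induction shift the
  -- sequence of maps. The chains valid up to `j` form nested nonempty closed sets in the compact
  -- product `ℕ → X`.
  have hne : ∀ (j : ℕ) (F : ℕ → X → X), ∃ p : ℕ → X, ∀ k < j, p k = F k (p (k + 1)) := by
    intro j
    induction j with
    | zero => exact fun _ => ⟨fun _ => Classical.arbitrary X, by simp⟩
    | succ j ih =>
      intro F
      obtain ⟨p, hp⟩ := ih fun k => F (k + 1)
      refine ⟨fun k => Nat.casesOn k (F 0 (p 0)) p, fun k hk => ?_⟩
      cases k with
      | zero => rfl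
      | succ k => exact hp k (by omega)
  have hcl : ∀ j, IsClosed {p : ℕ → X | ∀ k < j, p k = F k (p (k + 1))} := by
    intro j
    simp only [ofPred_forall]
    exact isClosed_iInter fun k => isClosed_iInter fun _ =>
      isClosed_eq (continuous_apply k) ((hF k).comp (continuous_apply (k + 1)))
  obtain ⟨p, hp⟩ := IsCompact.nonempty_iInter_of_sequence_nonempty_isCompact_isClosed
    (fun j => {p : ℕ → X | ∀ k < j, p k = F k (p (k + 1))})
    (fun j p hp k hk => hp k (by omega)) (fun j => hne j F) (hcl 0).isCompact hcl
  exact ⟨p, fun k => mem_iInter.1 hp (k + 1) k (by omega)⟩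

/-! ### Dyadic points -/

namespace DyadicPt

theorem num_pos (a : DyadicPt) : 0 < a.num := a.num_odd.pos

theorem val_mul (a : DyadicPt) : a.val * 2 ^ a.level = a.num := by
  unfold val; field_simp

theorem half_pow_le_val (a : DyadicPt) : (1 / 2 : ℝ) ^ a.level ≤ a.val := by
  have h : (1 : ℝ) ≤ a.num := by exact_mod_cast a.num_pos
  rw [one_div_pow, val]
  gcongr

theorem val_le (a : DyadicPt) : a.val ≤ 1 - (1 / 2 : ℝ) ^ a.level := by
  have h : (a.num : ℝ) + 1 ≤ 2 ^ a.level := by exact_mod_cast a.num_lt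
  rw [one_div_pow, val, le_sub_iff_add_le, ← add_div]
  exact (div_le_one (by positivity)).2 h

theorem val_pos (a : DyadicPt) : 0 < a.val :=
  lt_of_lt_of_le (by positivity) a.half_pow_le_val

theorem val_lt_one (a : DyadicPt) : a.val < 1 :=
  lt_of_le_of_lt a.val_le (sub_lt_self _ (by positivity))

/-- Equal values with levels differing by `d` give `b.num = a.num * 2 ^ d`, and an odd numerator
forces `d = 0`. -/
theorem val_injective : Function.Injective val := by
  have key : ∀ a b : DyadicPt, a.val = b.val → a.level ≤ b.level → a = b := by
    intro a b h hl
    obtain ⟨d, hd⟩ := Nat.exists_eq_add_of_le hl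
    have h1 : b.num = a.num * 2 ^ d := by
      have : (b.num : ℝ) = a.num * 2 ^ d := by
        rw [← val_mul, ← val_mul, h, hd, pow_add, mul_assoc]
      exact_mod_cast this
    have hd0 : d = 0 := by
      by_contra hne
      obtain ⟨e, rfl⟩ := Nat.exists_eq_succ_of_ne_zero hne
      have := b.num_odd
      rw [h1, pow_succ, ← mul_assoc] at this
      exact (Nat.not_odd_iff_even.2 (even_two.mul_left _)) this
    subst hd0
    cases a; cases b
    simp_all
  intro a b h
  rcases le_total a.level b.level with hl | hl
  · exact key a b h hl
  · exact (key b a h.symm hl).symm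

/-- Two dyadic points differ by at least the reciprocal of the larger denominator. -/
theorem val_add_le_of_lt {a b : DyadicPt} (h : a.val < b.val) :
    a.val + (1 / 2 : ℝ) ^ max a.level b.level ≤ b.val := by
  set M := max a.level b.level
  obtain ⟨d, hd⟩ := Nat.exists_eq_add_of_le (le_max_left a.level b.level)
  obtain ⟨e, he⟩ := Nat.exists_eq_add_of_le (le_max_right a.level b.level)
  have ha : a.val * 2 ^ M = ((a.num * 2 ^ d : ℕ) : ℝ) := by
    simp only [M]; rw [hd, pow_add, ← mul_assoc, val_mul]; push_cast; rfl
  have hb : b.val * 2 ^ M = ((b.num * 2 ^ e : ℕ) : ℝ) := by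
    simp only [M]; rw [he, pow_add, ← mul_assoc, val_mul]; push_cast; rfl
  have hpos : (0 : ℝ) < 2 ^ M := by positivity
  have hlt : a.num * 2 ^ d < b.num * 2 ^ e := by
    have := mul_lt_mul_of_pos_right h hpos
    rw [ha, hb] at this
    exact_mod_cast this
  have hle : ((a.num * 2 ^ d : ℕ) : ℝ) + 1 ≤ ((b.num * 2 ^ e : ℕ) : ℝ) := by
    exact_mod_cast hlt
  rw [← ha, ← hb] at hle
  refine le_of_mul_le_mul_right ?_ hpos
  rwa [add_mul, one_div_pow, one_div, inv_mul_cancel₀ hpos.ne']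

/-- Once `2 ^ (-l) < t - s`, some `n / 2 ^ l` lies between. Cancelling factors of two reaches lowest
terms; it cannot end at exponent 0, as no integer lies strictly between 0 and 1. -/
theorem exists_val_mem_Ioo {s t : ℝ} (hs : 0 ≤ s) (hst : s < t) (ht : t ≤ 1) :
    ∃ a : DyadicPt, a.val ∈ Ioo s t := by
  have key : ∀ (l n : ℕ), s < (n : ℝ) / 2 ^ l → (n : ℝ) / 2 ^ l < t →
      ∃ a : DyadicPt, a.val ∈ Ioo s t := by
    intro l
    induction l with
    | zero =>
      intro n h1 h2
      simp only [pow_zero, div_one] at h1 h2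
      have h3 : (0 : ℝ) < n := hs.trans_lt h1
      have h4 : (n : ℝ) < 1 := h2.trans_le ht
      norm_cast at h3 h4
      omega
    | succ l ih =>
      intro n h1 h2
      rcases Nat.even_or_odd n with ⟨k, rfl⟩ | hn
      · have : ((k + k : ℕ) : ℝ) / 2 ^ (l + 1) = (k : ℝ) / 2 ^ l := by
          push_cast; field_simp; ring
        rw [this] at h1 h2
        exact ih k h1 h2
      · refine ⟨⟨n, l + 1, hn, ?_⟩, h1, h2⟩
        have := (div_lt_one (by positivity)).1 (h2.trans_le ht)
        exact_mod_cast this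
  obtain ⟨l, hl⟩ := exists_pow_lt_of_lt_one (sub_pos.2 hst) (by norm_num : (1 / 2 : ℝ) < 1)
  rw [one_div_pow] at hl
  have hpos : (0 : ℝ) < 2 ^ l := by positivity
  refine key l (⌊s * 2 ^ l⌋₊ + 1) ?_ ?_
  · rw [lt_div_iff₀ hpos]
    exact_mod_cast Nat.lt_floor_add_one (s * 2 ^ l)
  · rw [div_lt_iff₀ hpos]
    have h1 := Nat.floor_le (mul_nonneg hs hpos.le)
    rw [div_lt_iff₀ hpos] at hl
    push_cast
    linarith

theorem finite_setOf_level_add_lt (M : ℕ) :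
    {i : DyadicPt × ℕ | i.1.level + i.2 < M}.Finite := by
  have hinj : Function.Injective fun i : DyadicPt × ℕ => (i.1.num, i.1.level, i.2) := by
    rintro ⟨⟨_, _, _, _⟩, _⟩ ⟨⟨_, _, _, _⟩, _⟩ h
    simp_all
  refine Finite.of_finite_image (f := fun i : DyadicPt × ℕ => (i.1.num, i.1.level, i.2)) ?_
    hinj.injOn
  refine (((finite_Iio (2 ^ M)).prod ((finite_Iio M).prod (finite_Iio M)))).subset ?_
  rintro _ ⟨⟨a, m⟩, h, rfl⟩
  simp only [mem_ofPred_eq] at h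
  have h1 : a.level < M := by omega
  have h2 : m < M := by omega
  exact ⟨a.num_lt.trans_le (Nat.pow_le_pow_right two_pos h1.le), h1, h2⟩

/-- Bounds the sizes of the attached copies: only finitely many pairs have `level + m` below a given
bound. -/
theorem tendsto_half_pow_level_add :
    Tendsto (fun i : DyadicPt × ℕ => (1 / 2 : ℝ) ^ (i.1.level + i.2)) cofinite (𝓝 0) := by
  refine (tendsto_pow_atTop_nhds_zero_of_lt_one (by norm_num) (by norm_num)).comp
    (tendsto_atTop.2 fun M => ?_)
  refine (finite_setOf_level_add_lt M).subset fun i hi => ?_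
  simpa using hi

instance : Countable DyadicPt := by
  have hinj : Function.Injective fun a : DyadicPt => (a.num, a.level) := by
    rintro ⟨_, _, _, _⟩ ⟨_, _, _, _⟩ h
    simp_all
  exact hinj.countable

end DyadicPt

/-! ### Geometry of the maps -/

theorem Plane.ext {p q : Plane} (h0 : p 0 = q 0) (h1 : p 1 = q 1) : p = q := by
  ext i; fin_cases i <;> assumption

theorem Plane.norm_le (p : Plane) : ‖p‖ ≤ |p 0| + |p 1| := by
  rw [EuclideanSpace.norm_eq, Fin.sum_univ_two, Real.norm_eq_abs, Real.norm_eq_abs]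
  refine Real.sqrt_le_iff.2 ⟨by positivity, ?_⟩
  nlinarith [abs_nonneg (p 0), abs_nonneg (p 1)]

theorem Plane.abs_apply_le (p : Plane) (i : Fin 2) : |p i| ≤ ‖p‖ :=
  PiLp.norm_apply_le p i

section coordinates
variable (n m : ℕ) (a : DyadicPt) (p : Plane) (r : ℝ)

@[simp] theorem rootMap_zero_apply_zero : rootMap 0 p 0 = -p 0 := by simp [rootMap]
@[simp] theorem rootMap_zero_apply_one : rootMap 0 p 1 = -p 1 := by simp [rootMap]
@[simp] theorem rootMap_one_apply_zero : rootMap 1 p 0 = -p 1 := by simp [rootMap]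
@[simp] theorem rootMap_one_apply_one : rootMap 1 p 1 = p 0 := by simp [rootMap]
@[simp] theorem rootMap_add_two_apply_zero :
    rootMap (n + 2) p 0 = (1 / 2 : ℝ) ^ (n + 2) * p 0 := by simp [rootMap]
@[simp] theorem rootMap_add_two_apply_one :
    rootMap (n + 2) p 1 = (1 / 2 : ℝ) ^ (n + 2) * ((1 / 4 : ℝ) ^ (n + 2) * (p 0 + p 1)) := by
  simp [rootMap]
@[simp] theorem attachMap_apply_zero : attachMap a m p 0 =
    a.val + (1 / 2 : ℝ) ^ (a.level + 1 + m) * ((1 / 4 : ℝ) ^ m * (p 0 - p 1 / 2)) := by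
  simp [attachMap]
@[simp] theorem attachMap_apply_one :
    attachMap a m p 1 = (1 / 2 : ℝ) ^ (a.level + 1 + m) * p 0 := by simp [attachMap]
@[simp] theorem localPt_nil_apply_zero : localPt [] r 0 = r := by simp [localPt]
@[simp] theorem localPt_nil_apply_one : localPt [] r 1 = 0 := by simp [localPt]

end coordinates

theorem localPt_nil_zero : localPt [] 0 = 0 := Plane.ext (by simp) (by simp)

theorem attachMap_zero (a : DyadicPt) (m : ℕ) : attachMap a m 0 = localPt [] a.val :=
  Plane.ext (by simp) (by simp)

theorem rootMap_sub (n : ℕ) (p q : Plane) : rootMap n p - rootMap n q = rootMap n (p - q) := by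
  match n with
  | 0 => exact Plane.ext (by simp; ring) (by simp; ring)
  | 1 => exact Plane.ext (by simp; ring) (by simp)
  | n + 2 => exact Plane.ext (by simp; ring) (by simp; ring)

@[simp] theorem rootMap_apply_origin (n : ℕ) : rootMap n 0 = 0 := by
  simpa using (rootMap_sub n 0 0).symm

/-- The factor 4 compensates for `n = 1`, where the map is a rotation and does not shrink, and for
estimating the norm by the sum of coordinates. -/
theorem norm_rootMap_le (n : ℕ) (p : Plane) : ‖rootMap n p‖ ≤ (1 / 2 : ℝ) ^ n * (4 * ‖p‖) := by
  have h0 := p.abs_apply_le 0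
  have h1 := p.abs_apply_le 1
  have hn := norm_nonneg p
  match n with
  | 0 =>
    refine (Plane.norm_le _).trans ?_
    simp only [rootMap_zero_apply_zero, rootMap_zero_apply_one, abs_neg, pow_zero]
    linarith
  | 1 =>
    refine (Plane.norm_le _).trans ?_
    simp only [rootMap_one_apply_zero, rootMap_one_apply_one, abs_neg, pow_one]
    linarith
  | n + 2 =>
    refine (Plane.norm_le _).trans ?_
    simp only [rootMap_add_two_apply_zero, rootMap_add_two_apply_one, abs_mul]
    rw [abs_of_nonneg (by positivity : (0 : ℝ) ≤ (1 / 2 : ℝ) ^ (n + 2)),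
      abs_of_nonneg (by positivity : (0 : ℝ) ≤ (1 / 4 : ℝ) ^ (n + 2)), ← mul_add]
    have h4 : (1 / 4 : ℝ) ^ (n + 2) ≤ 1 := pow_le_one₀ (by norm_num) (by norm_num)
    have h5 : (1 / 4 : ℝ) ^ (n + 2) * |p 0 + p 1| ≤ 1 * (|p 0| + |p 1|) :=
      mul_le_mul h4 (abs_add_le _ _) (abs_nonneg _) zero_le_one
    gcongr
    linarith

theorem dist_rootMap_le (n : ℕ) (p q : Plane) :
    dist (rootMap n p) (rootMap n q) ≤ (1 / 2 : ℝ) ^ n * (4 * dist p q) := by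
  rw [dist_eq_norm, dist_eq_norm, rootMap_sub]
  exact norm_rootMap_le n _

theorem dist_rootMap_le_four_mul (n : ℕ) (p q : Plane) :
    dist (rootMap n p) (rootMap n q) ≤ 4 * dist p q :=
  (dist_rootMap_le n p q).trans
    (mul_le_of_le_one_left (by positivity) (pow_le_one₀ (by norm_num) (by norm_num)))

theorem continuous_rootMap (n : ℕ) : Continuous (rootMap n) :=
  (LipschitzWith.of_dist_le_mul (K := 4) fun p q => dist_rootMap_le_four_mul n p q).continuous

theorem continuous_attachMap (a : DyadicPt) (m : ℕ) : Continuous (attachMap a m) := by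
  unfold attachMap
  refine continuous_const.add ((continuous_const_smul _).comp ?_)
  refine (PiLp.continuous_toLp 2 _).comp (continuous_pi fun i => ?_)
  fin_cases i <;> simp <;> fun_prop

theorem dist_localPt_nil (r s : ℝ) : dist (localPt [] r) (localPt [] s) ≤ |r - s| := by
  rw [dist_eq_norm]
  refine (Plane.norm_le _).trans ?_
  simp

theorem continuous_localPt_nil : Continuous (localPt []) :=
  (LipschitzWith.of_dist_le_mul (K := 1) fun r s => by
    simpa using! dist_localPt_nil r s).continuous

/-- The triangle with vertices `(0, 0)`, `(1, 0)` and `(1, 1)`. -/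
def unitTriangle : Set Plane := {p | 0 ≤ p 1 ∧ p 1 ≤ p 0 ∧ p 0 ≤ 1}

theorem isClosed_unitTriangle : IsClosed unitTriangle := by
  have h : ∀ i : Fin 2, Continuous fun p : Plane => p i := fun i => by fun_prop
  exact (isClosed_le continuous_const (h 1)).inter
    ((isClosed_le (h 1) (h 0)).inter (isClosed_le (h 0) continuous_const))

theorem norm_le_two_of_mem_unitTriangle {p : Plane} (hp : p ∈ unitTriangle) : ‖p‖ ≤ 2 := by
  obtain ⟨h1, h2, h3⟩ := hp
  refine (Plane.norm_le _).trans ?_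
  rw [abs_of_nonneg h1, abs_of_nonneg (h1.trans h2)]
  linarith

theorem isCompact_unitTriangle : IsCompact unitTriangle :=
  Metric.isCompact_of_isClosed_isBounded isClosed_unitTriangle
    (isBounded_iff_forall_norm_le.2 ⟨2, fun _ => norm_le_two_of_mem_unitTriangle⟩)

theorem eq_zero_of_mem_unitTriangle {p : Plane} (hp : p ∈ unitTriangle) (h : p 0 ≤ 0) :
    p = 0 := by
  obtain ⟨h1, h2, h3⟩ := hp
  exact Plane.ext (by simp; linarith) (by simp; linarith)

theorem localPt_nil_mem_unitTriangle {r : ℝ} (hr : r ∈ Icc (0 : ℝ) 1) :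
    localPt [] r ∈ unitTriangle :=
  ⟨by simp, by simpa using hr.1, by simpa using hr.2⟩

/-- The image has width and height at most `2 ^ (-(level + 1))`, while `a.val` stays at least `2 ^
(-level)` away from both 0 and 1. -/
theorem attachMap_mem_unitTriangle (a : DyadicPt) (m : ℕ) {p : Plane} (hp : p ∈ unitTriangle) :
    attachMap a m p ∈ unitTriangle := by
  obtain ⟨h1, h2, h3⟩ := hp
  have hh : (1 / 2 : ℝ) ^ (a.level + 1 + m) ≤ (1 / 2 : ℝ) ^ a.level :=
    pow_le_pow_of_le_one (by norm_num) (by norm_num) (by omega)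
  have hpos : (0 : ℝ) < (1 / 2 : ℝ) ^ (a.level + 1 + m) := by positivity
  have h4 : (1 / 4 : ℝ) ^ m ≤ 1 := pow_le_one₀ (by norm_num) (by norm_num)
  have h4' : (0 : ℝ) < (1 / 4 : ℝ) ^ m := by positivity
  have h5 : (1 / 4 : ℝ) ^ m * (p 0 - p 1 / 2) ≤ 1 * 1 :=
    mul_le_mul h4 (by linarith) (by linarith) zero_le_one
  have h6 : 0 ≤ (1 / 2 : ℝ) ^ (a.level + 1 + m) * ((1 / 4 : ℝ) ^ m * (p 0 - p 1 / 2)) :=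
    mul_nonneg hpos.le (mul_nonneg h4'.le (by linarith))
  have ha := a.half_pow_le_val
  have ha' := a.val_le
  refine ⟨?_, ?_, ?_⟩
  · rw [attachMap_apply_one]
    exact mul_nonneg hpos.le (h1.trans h2)
  · rw [attachMap_apply_one, attachMap_apply_zero]
    have := mul_le_mul_of_nonneg_left h3 hpos.le
    linarith
  · rw [attachMap_apply_zero]
    have := mul_le_mul_of_nonneg_left h5 hpos.le
    linarith

theorem localPt_mem_unitTriangle (τ : List (DyadicPt × ℕ)) {r : ℝ} (hr : r ∈ Icc (0 : ℝ) 1) :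
    localPt τ r ∈ unitTriangle := by
  induction τ with
  | nil => exact localPt_nil_mem_unitTriangle hr
  | cons am τ ih => exact attachMap_mem_unitTriangle am.1 am.2 ih

theorem dist_attachMap_le (a : DyadicPt) (m : ℕ) {p : Plane} (hp : p ∈ unitTriangle) :
    dist (attachMap a m p) (localPt [] a.val) ≤ (1 / 2 : ℝ) ^ (a.level + m) := by
  obtain ⟨h1, h2, h3⟩ := hp
  have h4 : (1 / 4 : ℝ) ^ m ≤ 1 := pow_le_one₀ (by norm_num) (by norm_num)
  have h5 : (1 / 4 : ℝ) ^ m * (p 0 - p 1 / 2) ≤ 1 * 1 :=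
    mul_le_mul h4 (by linarith) (by linarith) zero_le_one
  have h6 : 0 ≤ (1 / 4 : ℝ) ^ m * (p 0 - p 1 / 2) :=
    mul_nonneg (by positivity) (by linarith)
  have e : (1 / 2 : ℝ) ^ (a.level + m) = (1 / 2 : ℝ) ^ (a.level + 1 + m) * (1 + 1) := by
    ring
  rw [dist_eq_norm, e]
  refine (Plane.norm_le _).trans ?_
  simp only [PiLp.sub_apply, attachMap_apply_zero, attachMap_apply_one, localPt_nil_apply_zero,
    localPt_nil_apply_one, add_sub_cancel_left, sub_zero, abs_mul]
  rw [← abs_mul ((1 / 4 : ℝ) ^ m), abs_of_nonneg h6, abs_of_nonneg (h1.trans h2),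
    abs_of_nonneg (by positivity : (0 : ℝ) ≤ (1 / 2 : ℝ) ^ (a.level + 1 + m)), ← mul_add]
  gcongr
  linarith

/-! ### Separation of the images of the triangle -/

theorem rootMap_injective (n : ℕ) : Function.Injective (rootMap n) := by
  intro p q h
  have h0 := congrArg (fun z : Plane => z 0) h
  have h1 := congrArg (fun z : Plane => z 1) h
  match n with
  | 0 =>
    simp only [rootMap_zero_apply_zero, rootMap_zero_apply_one] at h0 h1
    exact Plane.ext (by linarith) (by linarith)
  | 1 =>
    simp only [rootMap_one_apply_zero, rootMap_one_apply_one] at h0 h1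
    exact Plane.ext (by linarith) (by linarith)
  | n + 2 =>
    simp only [rootMap_add_two_apply_zero, rootMap_add_two_apply_one] at h0 h1
    have h2 := mul_left_cancel₀ (by positivity) h0
    have h3 := mul_left_cancel₀ (by positivity) (mul_left_cancel₀ (by positivity) h1)
    exact Plane.ext h2 (by linarith)

/-- The images for 0, 1 and larger indices lie in the third, second and first quadrants. For `n ≥ 2`
the slopes in the image lie between `4 ^ (-n)` and `2 * 4 ^ (-n)`, and these ranges are disjoint for
different `n`. -/
theorem eq_zero_of_rootMap_eq_rootMap {n m : ℕ} (hnm : n < m) {p q : Plane}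
    (hp : p ∈ unitTriangle) (hq : q ∈ unitTriangle) (h : rootMap n p = rootMap m q) : p = 0 := by
  refine eq_zero_of_mem_unitTriangle hp ?_
  obtain ⟨hp1, hp2, hp3⟩ := hp
  obtain ⟨hq1, hq2, hq3⟩ := hq
  have h0 := congrArg (fun z : Plane => z 0) h
  have h1 := congrArg (fun z : Plane => z 1) h
  match n, m with
  | 0, 1 =>
    simp only [rootMap_zero_apply_zero, rootMap_zero_apply_one, rootMap_one_apply_zero,
      rootMap_one_apply_one] at h0 h1
    linarith
  | 0, m + 2 =>
    simp only [rootMap_zero_apply_zero, rootMap_add_two_apply_zero] at h0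
    have : 0 ≤ (1 / 2 : ℝ) ^ (m + 2) * q 0 := mul_nonneg (by positivity) (by linarith)
    linarith
  | 1, m + 2 =>
    simp only [rootMap_one_apply_zero, rootMap_one_apply_one, rootMap_add_two_apply_zero,
      rootMap_add_two_apply_one] at h0 h1
    have hpos : (0 : ℝ) < (1 / 2 : ℝ) ^ (m + 2) := by positivity
    have hq0 : q 0 ≤ 0 := by
      refine nonpos_of_mul_nonpos_right (a := (1 / 2 : ℝ) ^ (m + 2)) ?_ hpos
      linarith
    have hq0' : q 0 = 0 := by linarith
    have hq1' : q 1 = 0 := by linarith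
    rw [hq0', hq1'] at h1
    simp only [add_zero, mul_zero] at h1
    exact h1.le
  | n + 2, m + 2 =>
    simp only [rootMap_add_two_apply_zero, rootMap_add_two_apply_one] at h0 h1
    have hpos : (0 : ℝ) < (1 / 2 : ℝ) ^ (n + 2) := by positivity
    have hpos' : (0 : ℝ) < (1 / 2 : ℝ) ^ (m + 2) := by positivity
    have he : (1 / 4 : ℝ) ^ (m + 2) ≤ (1 / 4 : ℝ) ^ (n + 2) / 4 := by
      calc (1 / 4 : ℝ) ^ (m + 2) ≤ (1 / 4 : ℝ) ^ (n + 3) :=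
            pow_le_pow_of_le_one (by norm_num) (by norm_num) (by omega)
        _ = _ := by ring
    have hepos : (0 : ℝ) < (1 / 4 : ℝ) ^ (n + 2) := by positivity
    generalize (1 / 4 : ℝ) ^ (n + 2) = e at *
    generalize (1 / 4 : ℝ) ^ (m + 2) = e' at *
    generalize (1 / 2 : ℝ) ^ (n + 2) = c at *
    generalize (1 / 2 : ℝ) ^ (m + 2) = c' at *
    have hX : 0 ≤ c * p 0 := mul_nonneg hpos.le (hp1.trans hp2)
    have h2 : e * (c * p 0) ≤ c * (e * (p 0 + p 1)) := by
      have : 0 ≤ c * (e * p 1) := by positivity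
      linarith
    have h3 : c' * (e' * (q 0 + q 1)) ≤ 2 * (e / 4) * (c' * q 0) := by
      have h4 : c' * (e' * (q 0 + q 1)) ≤ c' * (e / 4 * (2 * q 0)) := by
        gcongr
        · linarith
        · linarith
      linarith
    rw [← h0] at h3
    have h5 : e * (c * p 0) ≤ 0 := by linarith
    have h6 : c * p 0 ≤ 0 := nonpos_of_mul_nonpos_right h5 hepos
    exact nonpos_of_mul_nonpos_right h6 hpos

theorem rootMap_eq_rootMap {n m : ℕ} {p q : Plane} (hp : p ∈ unitTriangle)
    (hq : q ∈ unitTriangle) (h : rootMap n p = rootMap m q) :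
    (p = 0 ∧ q = 0) ∨ (n = m ∧ p = q) := by
  rcases lt_trichotomy n m with hnm | rfl | hnm
  · have hp0 := eq_zero_of_rootMap_eq_rootMap hnm hp hq h
    subst hp0
    rw [rootMap_apply_origin] at h
    exact Or.inl ⟨rfl, rootMap_injective m (by rw [← h, rootMap_apply_origin])⟩
  · exact Or.inr ⟨rfl, rootMap_injective n h⟩
  · have hq0 := eq_zero_of_rootMap_eq_rootMap hnm hq hp h.symm
    subst hq0
    rw [rootMap_apply_origin] at h
    exact Or.inl ⟨rootMap_injective n (by rw [h, rootMap_apply_origin]), rfl⟩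

theorem attachMap_injective (a : DyadicPt) (m : ℕ) : Function.Injective (attachMap a m) := by
  intro p q h
  have h0 := congrArg (fun z : Plane => z 0) h
  have h1 := congrArg (fun z : Plane => z 1) h
  simp only [attachMap_apply_zero, attachMap_apply_one] at h0 h1
  have h2 := mul_left_cancel₀ (by positivity) h1
  have h3 := mul_left_cancel₀ (by positivity)
    (mul_left_cancel₀ (by positivity) (add_left_cancel h0))
  exact Plane.ext h2 (by linarith)

theorem attachMap_apply_zero_le (a : DyadicPt) (m : ℕ) {p : Plane} (hp : p ∈ unitTriangle) :
    attachMap a m p 0 ≤ a.val + attachMap a m p 1 := by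
  obtain ⟨h1, h2, h3⟩ := hp
  rw [attachMap_apply_zero, attachMap_apply_one]
  have h4 : (1 / 4 : ℝ) ^ m ≤ 1 := pow_le_one₀ (by norm_num) (by norm_num)
  have h5 : (1 / 4 : ℝ) ^ m * (p 0 - p 1 / 2) ≤ 1 * p 0 :=
    mul_le_mul h4 (by linarith) (by linarith) zero_le_one
  rw [one_mul] at h5
  gcongr

theorem val_le_attachMap_apply_zero (a : DyadicPt) (m : ℕ) {p : Plane} (hp : p ∈ unitTriangle) :
    a.val ≤ attachMap a m p 0 := by
  obtain ⟨h1, h2, h3⟩ := hp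
  rw [attachMap_apply_zero]
  exact le_add_of_nonneg_right
    (mul_nonneg (by positivity) (mul_nonneg (by positivity) (by linarith)))

theorem attachMap_apply_one_lt (a : DyadicPt) (m : ℕ) {p : Plane} (hp : p ∈ unitTriangle) :
    attachMap a m p 1 < (1 / 2 : ℝ) ^ a.level := by
  obtain ⟨h1, h2, h3⟩ := hp
  rw [attachMap_apply_one]
  calc (1 / 2 : ℝ) ^ (a.level + 1 + m) * p 0 ≤ (1 / 2 : ℝ) ^ (a.level + 1 + m) * 1 := by gcongr
    _ < (1 / 2 : ℝ) ^ a.level := by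
      rw [mul_one]
      exact pow_lt_pow_right_of_lt_one₀ (by norm_num) (by norm_num) (by omega)

/-- A common point `(x, y)` would satisfy `b.val ≤ x ≤ a.val + y` with `y` below both `2 ^
(-a.level)` and `2 ^ (-b.level)`; but dyadics of these levels differ by at least the smaller of the
two. -/
theorem attachMap_ne_of_val_lt {a b : DyadicPt} (hab : a.val < b.val) (m k : ℕ) {p q : Plane}
    (hp : p ∈ unitTriangle) (hq : q ∈ unitTriangle) : attachMap a m p ≠ attachMap b k q := by
  intro h
  have h1 := attachMap_apply_zero_le a m hp
  have h2 := val_le_attachMap_apply_zero b k hq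
  have h3 := DyadicPt.val_add_le_of_lt hab
  have h4 := attachMap_apply_one_lt a m hp
  have h5 := attachMap_apply_one_lt b k hq
  rw [h] at h1 h4
  rcases max_choice a.level b.level with hm | hm <;> rw [hm] at h3 <;> linarith

/-- Away from the center, horizontal offset over height lies between `4 ^ (-m) / 2` and `4 ^ (-m)`
in the `m`-th copy, but is at most `4 ^ (-m) / 4` in the `k`-th. -/
theorem eq_zero_of_attachMap_eq_attachMap (a : DyadicPt) {m k : ℕ} (hmk : m < k) {p q : Plane}
    (hp : p ∈ unitTriangle) (hq : q ∈ unitTriangle) (h : attachMap a m p = attachMap a k q) :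
    p = 0 := by
  refine eq_zero_of_mem_unitTriangle hp ?_
  obtain ⟨hp1, hp2, hp3⟩ := hp
  obtain ⟨hq1, hq2, hq3⟩ := hq
  have h0 := congrArg (fun z : Plane => z 0) h
  have h1 := congrArg (fun z : Plane => z 1) h
  simp only [attachMap_apply_zero, attachMap_apply_one] at h0 h1
  replace h0 := add_left_cancel h0
  have hpos : (0 : ℝ) < (1 / 2 : ℝ) ^ (a.level + 1 + m) := by positivity
  have hpos' : (0 : ℝ) < (1 / 2 : ℝ) ^ (a.level + 1 + k) := by positivity
  have he : (1 / 4 : ℝ) ^ k ≤ (1 / 4 : ℝ) ^ m / 4 := by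
    calc (1 / 4 : ℝ) ^ k ≤ (1 / 4 : ℝ) ^ (m + 1) :=
          pow_le_pow_of_le_one (by norm_num) (by norm_num) (by omega)
      _ = _ := by ring
  have hepos : (0 : ℝ) < (1 / 4 : ℝ) ^ m := by positivity
  generalize (1 / 4 : ℝ) ^ m = e at *
  generalize (1 / 4 : ℝ) ^ k = e' at *
  generalize (1 / 2 : ℝ) ^ (a.level + 1 + m) = c at *
  generalize (1 / 2 : ℝ) ^ (a.level + 1 + k) = c' at *
  have h2 : e / 2 * (c * p 0) ≤ c * (e * (p 0 - p 1 / 2)) := by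
    have : 0 ≤ c * e * (p 0 - p 1) := mul_nonneg (by positivity) (by linarith)
    linarith
  have h3 : c' * (e' * (q 0 - q 1 / 2)) ≤ e / 4 * (c' * q 0) := by
    have h4 : c' * (e' * (q 0 - q 1 / 2)) ≤ c' * (e / 4 * q 0) := by
      refine mul_le_mul_of_nonneg_left ?_ hpos'.le
      exact mul_le_mul he (by linarith) (by linarith) (by positivity)
    linarith
  rw [← h1] at h3
  have h5 : e * (c * p 0) ≤ 0 := by linarith
  have h6 : c * p 0 ≤ 0 := nonpos_of_mul_nonpos_right h5 hepos
  exact nonpos_of_mul_nonpos_right h6 hpos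

theorem attachMap_eq_attachMap {a b : DyadicPt} {m k : ℕ} {p q : Plane} (hp : p ∈ unitTriangle)
    (hq : q ∈ unitTriangle) (h : attachMap a m p = attachMap b k q) :
    (p = 0 ∧ q = 0) ∨ (a = b ∧ m = k ∧ p = q) := by
  rcases lt_trichotomy a.val b.val with hab | hab | hab
  · exact absurd h (attachMap_ne_of_val_lt hab m k hp hq)
  · obtain rfl := DyadicPt.val_injective hab
    rcases lt_trichotomy m k with hmk | rfl | hmk
    · have hp0 := eq_zero_of_attachMap_eq_attachMap a hmk hp hq h
      subst hp0
      exact Or.inl ⟨rfl, attachMap_injective a k (by rw [← h, attachMap_zero, attachMap_zero])⟩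
    · exact Or.inr ⟨rfl, rfl, attachMap_injective a m h⟩
    · have hq0 := eq_zero_of_attachMap_eq_attachMap a hmk hq hp h.symm
      subst hq0
      exact Or.inl ⟨attachMap_injective a m (by rw [h, attachMap_zero, attachMap_zero]), rfl⟩
  · exact absurd h.symm (attachMap_ne_of_val_lt hab k m hq hp)

theorem eq_zero_of_attachMap_eq_localPt_nil {a : DyadicPt} {m : ℕ} {p : Plane} {r : ℝ}
    (hp : p ∈ unitTriangle) (h : attachMap a m p = localPt [] r) : p = 0 := by
  have h1 := congrArg (fun z : Plane => z 1) h
  simp only [attachMap_apply_one, localPt_nil_apply_one] at h1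
  exact eq_zero_of_mem_unitTriangle hp
    ((mul_eq_zero.1 h1).resolve_left (by positivity)).le

/-! ### The dendrite as a union of small copies -/

/-- The part of the dendrite that grows on one beam of the star at the origin, pulled back to the
unit segment. -/
def localDendrite : Set Plane := closure {q | ∃ τ, ∃ r ∈ Icc (0 : ℝ) 1, localPt τ r = q}

theorem localPt_mem_localDendrite (τ : List (DyadicPt × ℕ)) {r : ℝ} (hr : r ∈ Icc (0 : ℝ) 1) :
    localPt τ r ∈ localDendrite :=
  subset_closure ⟨τ, r, hr, rfl⟩

theorem zero_mem_localDendrite : (0 : Plane) ∈ localDendrite :=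
  localPt_nil_zero ▸ localPt_mem_localDendrite [] (left_mem_Icc.2 zero_le_one)

theorem localDendrite_subset_unitTriangle : localDendrite ⊆ unitTriangle :=
  closure_minimal (by rintro _ ⟨τ, r, hr, rfl⟩; exact localPt_mem_unitTriangle τ hr)
    isClosed_unitTriangle

theorem isCompact_localDendrite : IsCompact localDendrite :=
  isCompact_unitTriangle.of_isClosed_subset isClosed_closure localDendrite_subset_unitTriangle

theorem attachMap_mem_localDendrite (a : DyadicPt) (m : ℕ) {p : Plane} (hp : p ∈ localDendrite) :
    attachMap a m p ∈ localDendrite := by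
  refine map_mem_closure (continuous_attachMap a m) hp ?_
  rintro _ ⟨τ, r, hr, rfl⟩
  exact ⟨(a, m) :: τ, r, hr, rfl⟩

theorem isCompact_image_localPt_nil : IsCompact (localPt [] '' Icc 0 1) :=
  isCompact_Icc.image continuous_localPt_nil

theorem DyadicPt.val_mem_Icc (a : DyadicPt) : a.val ∈ Icc (0 : ℝ) 1 :=
  ⟨a.val_pos.le, a.val_lt_one.le⟩

/-- The right side contains every finite itinerary point, and it is already closed because the
copies shrink to the segment. -/
theorem localDendrite_eq : localDendrite = localPt [] '' Icc 0 1 ∪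
    ⋃ i : DyadicPt × ℕ, attachMap i.1 i.2 '' localDendrite := by
  have hcl : IsClosed (localPt [] '' Icc 0 1 ∪
      ⋃ i : DyadicPt × ℕ, attachMap i.1 i.2 '' localDendrite) := by
    refine (isCompact_image_localPt_nil.union_iUnion_of_tendsto
      (K := fun i : DyadicPt × ℕ => attachMap i.1 i.2 '' localDendrite)
      (fun i => isCompact_localDendrite.image (continuous_attachMap i.1 i.2))
      DyadicPt.tendsto_half_pow_level_add ?_).isClosed
    rintro i _ ⟨p, hp, rfl⟩
    exact ⟨_, ⟨_, i.1.val_mem_Icc, rfl⟩,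
      dist_attachMap_le i.1 i.2 (localDendrite_subset_unitTriangle hp)⟩
  refine Subset.antisymm (closure_minimal ?_ hcl)
    (union_subset ?_ (iUnion_subset fun i => ?_))
  · rintro _ ⟨τ, r, hr, rfl⟩
    cases τ with
    | nil => exact Or.inl ⟨r, hr, rfl⟩
    | cons i τ =>
      exact Or.inr (mem_iUnion.2 ⟨i, mem_image_of_mem _ (localPt_mem_localDendrite τ hr)⟩)
  · rintro _ ⟨r, hr, rfl⟩
    exact localPt_mem_localDendrite [] hr
  · rintro _ ⟨p, hp, rfl⟩
    exact attachMap_mem_localDendrite i.1 i.2 hp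

theorem beam_subset_iUnion_stage (n : ℕ) (τ : List (DyadicPt × ℕ)) :
    beam n τ ⊆ ⋃ k : ℕ, stage k := fun _ hx =>
  mem_iUnion.2 ⟨τ.length + 1, mem_iUnion.2 ⟨n, mem_iUnion₂.2 ⟨τ, Nat.lt_succ_self _, hx⟩⟩⟩

theorem tendsto_half_pow_mul_const (c : ℝ) :
    Tendsto (fun n : ℕ => (1 / 2 : ℝ) ^ n * c) cofinite (𝓝 0) := by
  rw [Nat.cofinite_eq_atTop]
  simpa using (tendsto_pow_atTop_nhds_zero_of_lt_one (r := (1 / 2 : ℝ)) (by norm_num)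
    (by norm_num)).mul_const c

theorem dist_rootMap_origin_le (n : ℕ) {p : Plane} (hp : p ∈ unitTriangle) :
    dist (rootMap n p) 0 ≤ (1 / 2 : ℝ) ^ n * 8 := by
  rw [dist_zero_right]
  refine (norm_rootMap_le n p).trans ?_
  have := norm_le_two_of_mem_unitTriangle hp
  gcongr
  linarith

theorem isCompact_iUnion_rootMap {S : Set Plane} (hS : IsCompact S) (hST : S ⊆ unitTriangle)
    (h0 : (0 : Plane) ∈ S) : IsCompact (⋃ n, rootMap n '' S) := by
  have h := (isCompact_singleton (x := (0 : Plane))).union_iUnion_of_tendsto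
    (fun n => hS.image (continuous_rootMap n)) (tendsto_half_pow_mul_const 8) (by
      rintro n _ ⟨p, hp, rfl⟩
      exact ⟨0, rfl, dist_rootMap_origin_le n (hST hp)⟩)
  rwa [union_eq_self_of_subset_left] at h
  rintro _ rfl
  exact mem_iUnion.2 ⟨0, 0, h0, rootMap_apply_origin 0⟩

theorem rootMap_mem_Dinf (n : ℕ) {p : Plane} (hp : p ∈ localDendrite) : rootMap n p ∈ Dinf := by
  refine map_mem_closure (continuous_rootMap n) hp ?_
  rintro _ ⟨τ, r, hr, rfl⟩
  exact beam_subset_iUnion_stage n τ ⟨r, hr, rfl⟩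

theorem Dinf_eq_iUnion_rootMap : Dinf = ⋃ n, rootMap n '' localDendrite := by
  refine Subset.antisymm (closure_minimal ?_ ?_) (iUnion_subset fun n => ?_)
  · refine iUnion_subset fun k => iUnion_subset fun n => iUnion₂_subset fun τ _ => ?_
    rintro _ ⟨r, hr, rfl⟩
    exact mem_iUnion.2 ⟨n, _, localPt_mem_localDendrite τ hr, rfl⟩
  · exact (isCompact_iUnion_rootMap isCompact_localDendrite localDendrite_subset_unitTriangle
      zero_mem_localDendrite).isClosed
  · rintro _ ⟨p, hp, rfl⟩
    exact rootMap_mem_Dinf n hp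

instance : CompactSpace Dinf := by
  rw [← isCompact_iff_compactSpace, Dinf_eq_iUnion_rootMap]
  exact isCompact_iUnion_rootMap isCompact_localDendrite localDendrite_subset_unitTriangle
      zero_mem_localDendrite

/-! ### The shift map -/

/-- The graph of the shift map on all of `Dinf`. -/
inductive ShiftRel : Plane → Plane → Prop
  | base {r : ℝ} (hr : r ∈ Icc (0 : ℝ) 1) : ShiftRel (rootMap 0 (localPt [] r)) 0
  | pred (n : ℕ) {p : Plane} (hp : p ∈ localDendrite) : ShiftRel (rootMap (n + 1) p) (rootMap n p)
  | drop (a : DyadicPt) (m : ℕ) {p : Plane} (hp : p ∈ localDendrite) :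
      ShiftRel (rootMap 0 (attachMap a m p)) (rootMap (m + a.level) p)

theorem exists_shiftRel {x : Plane} (hx : x ∈ Dinf) : ∃ y ∈ Dinf, ShiftRel x y := by
  rw [Dinf_eq_iUnion_rootMap] at hx
  obtain ⟨n, p, hp, rfl⟩ := mem_iUnion.1 hx
  cases n with
  | succ n => exact ⟨_, rootMap_mem_Dinf n hp, .pred n hp⟩
  | zero =>
    rw [localDendrite_eq] at hp
    rcases hp with ⟨r, hr, rfl⟩ | hp
    · exact ⟨0, rootMap_apply_origin 0 ▸ rootMap_mem_Dinf 0 zero_mem_localDendrite, .base hr⟩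
    · obtain ⟨i, q, hq, rfl⟩ := mem_iUnion.1 hp
      exact ⟨_, rootMap_mem_Dinf _ hq, .drop i.1 i.2 hq⟩

theorem attachMap_eq_zero {a : DyadicPt} {m : ℕ} {p : Plane} (hp : p ∈ unitTriangle)
    (h : attachMap a m p = 0) : p = 0 :=
  eq_zero_of_attachMap_eq_localPt_nil (r := 0) hp (h.trans localPt_nil_zero.symm)

/-- By the separation lemmas, two clauses apply to the same point either with identical data or at a
center, or one is `base`; whenever the data differ, both values are the origin. -/
theorem ShiftRel.unique {x y z : Plane} (hy : ShiftRel x y) (hz : ShiftRel x z) : y = z := by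
  have hT := localDendrite_subset_unitTriangle
  have base_pred : ∀ {r : ℝ} (_ : r ∈ Icc (0 : ℝ) 1) (n : ℕ) {p : Plane}
      (_ : p ∈ localDendrite), rootMap 0 (localPt [] r) = rootMap (n + 1) p →
      rootMap n p = 0 := by
    intro r hr n p hp h
    rcases rootMap_eq_rootMap (localPt_nil_mem_unitTriangle hr) (hT hp) h with ⟨-, rfl⟩ | ⟨h, -⟩
    · exact rootMap_apply_origin n
    · omega
  have base_drop : ∀ {r : ℝ} (a : DyadicPt) (m : ℕ) {p : Plane} (_ : p ∈ localDendrite),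
      rootMap 0 (localPt [] r) = rootMap 0 (attachMap a m p) →
      rootMap (m + a.level) p = 0 := by
    intro r a m p hp h
    rw [eq_zero_of_attachMap_eq_localPt_nil (hT hp) (rootMap_injective 0 h).symm,
      rootMap_apply_origin]
  have pred_drop : ∀ (n : ℕ) {p : Plane} (_ : p ∈ localDendrite) (a : DyadicPt) (m : ℕ)
      {q : Plane} (_ : q ∈ localDendrite), rootMap (n + 1) p = rootMap 0 (attachMap a m q) →
      rootMap n p = rootMap (m + a.level) q := by
    intro n p hp a m q hq h
    rcases rootMap_eq_rootMap (hT hp) (attachMap_mem_unitTriangle a m (hT hq)) h with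
      ⟨rfl, hq0⟩ | ⟨h, -⟩
    · rw [attachMap_eq_zero (hT hq) hq0, rootMap_apply_origin, rootMap_apply_origin]
    · omega
  rcases hy with ⟨hr⟩ | ⟨n, hp⟩ | ⟨a, m, hp⟩ <;>
    generalize hx : rootMap _ _ = x at hz <;>
    rcases hz with ⟨hs⟩ | ⟨k, hq⟩ | ⟨b, k, hq⟩
  · rfl
  · exact (base_pred hr k hq hx).symm
  · exact (base_drop b k hq hx).symm
  · exact base_pred hs n hp hx.symm
  · rcases rootMap_eq_rootMap (hT hp) (hT hq) hx with ⟨rfl, rfl⟩ | ⟨h, rfl⟩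
    · rw [rootMap_apply_origin, rootMap_apply_origin]
    · rw [Nat.succ_injective h]
  · exact pred_drop n hp b k hq hx
  · exact base_drop a m hp hx.symm
  · exact (pred_drop k hq a m hp hx.symm).symm
  · rcases attachMap_eq_attachMap (hT hp) (hT hq) (rootMap_injective 0 hx) with
      ⟨rfl, rfl⟩ | ⟨rfl, rfl, rfl⟩
    · rw [rootMap_apply_origin, rootMap_apply_origin]
    · rfl

/-- Every piece shrinks to the graph of the zero map over the beam 0. For the `drop` pieces this is
where adding the level matters: a copy attached at a high level is sent to a root beam of high
index, hence near the origin. -/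
theorem isCompact_setOf_shiftRel : IsCompact {z : Plane × Plane | ShiftRel z.1 z.2} := by
  have hT := localDendrite_subset_unitTriangle
  have hC : IsCompact ((fun p : Plane => (rootMap 0 p, (0 : Plane))) '' (localPt [] '' Icc 0 1)) :=
    isCompact_image_localPt_nil.image ((continuous_rootMap 0).prodMk continuous_const)
  have h1 := hC.union_iUnion_of_tendsto
    (K := fun n => (fun p => (rootMap (n + 1) p, rootMap n p)) '' localDendrite)
    (fun n => isCompact_localDendrite.image
      ((continuous_rootMap (n + 1)).prodMk (continuous_rootMap n)))
    (tendsto_half_pow_mul_const 8) (by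
      rintro n _ ⟨p, hp, rfl⟩
      refine ⟨(0, 0), ⟨0, ⟨0, by simp, localPt_nil_zero⟩, by simp⟩, max_le ?_ ?_⟩
      · refine (dist_rootMap_origin_le (n + 1) (hT hp)).trans ?_
        gcongr ?_ * _
        exact pow_le_pow_of_le_one (by norm_num) (by norm_num) (Nat.le_succ n)
      · exact dist_rootMap_origin_le n (hT hp))
  have h2 := hC.union_iUnion_of_tendsto
    (K := fun i : DyadicPt × ℕ =>
      (fun p => (rootMap 0 (attachMap i.1 i.2 p), rootMap (i.2 + i.1.level) p)) '' localDendrite)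
    (d := fun i => (1 / 2 : ℝ) ^ (i.1.level + i.2) * 8)
    (fun i => isCompact_localDendrite.image
      (((continuous_rootMap 0).comp (continuous_attachMap i.1 i.2)).prodMk (continuous_rootMap _)))
    (by simpa using DyadicPt.tendsto_half_pow_level_add.mul_const 8) (by
      rintro i _ ⟨p, hp, rfl⟩
      refine ⟨_, ⟨_, ⟨_, i.1.val_mem_Icc, rfl⟩, rfl⟩, max_le ?_ ?_⟩
      · refine (dist_rootMap_le_four_mul 0 _ _).trans ?_
        have := dist_attachMap_le i.1 i.2 (hT hp)
        linarith [dist_nonneg.trans this]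
      · rw [add_comm i.1.level]
        exact dist_rootMap_origin_le _ (hT hp))
  refine (congrArg IsCompact (Subset.antisymm ?_ ?_)).mpr (h1.union h2)
  · rintro ⟨x, y⟩ hxy
    rcases hxy with ⟨hr⟩ | ⟨n, hp⟩ | ⟨a, m, hp⟩
    · exact Or.inl (Or.inl ⟨_, ⟨_, hr, rfl⟩, rfl⟩)
    · exact Or.inl (Or.inr (mem_iUnion.2 ⟨n, _, hp, rfl⟩))
    · exact Or.inr (Or.inr (mem_iUnion.2 ⟨(a, m), _, hp, rfl⟩))
  · have hbase : (fun p : Plane => (rootMap 0 p, (0 : Plane))) '' (localPt [] '' Icc 0 1) ⊆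
        {z : Plane × Plane | ShiftRel z.1 z.2} := by
      rintro _ ⟨_, ⟨r, hr, rfl⟩, rfl⟩
      exact .base hr
    refine union_subset (union_subset hbase (iUnion_subset fun n => ?_))
      (union_subset hbase (iUnion_subset fun i => ?_))
    · rintro _ ⟨p, hp, rfl⟩
      exact .pred n hp
    · rintro _ ⟨p, hp, rfl⟩
      exact .drop i.1 i.2 hp

theorem exists_continuousMap_shiftRel : ∃ f : C(Dinf, Dinf), ∀ x : Dinf, ShiftRel x (f x) := by
  choose g hgD hg using fun x : Dinf => exists_shiftRel x.2
  refine ⟨⟨fun x => ⟨g x, hgD x⟩, continuous_of_isClosed_graph_of_compactSpace ?_⟩, hg⟩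
  have : {z : Dinf × Dinf | (⟨g z.1, hgD z.1⟩ : Dinf) = z.2} =
      (fun z : Dinf × Dinf => ((z.1 : Plane), (z.2 : Plane))) ⁻¹'
        {z : Plane × Plane | ShiftRel z.1 z.2} := by
    ext ⟨x, y⟩
    refine ⟨fun h => ?_, fun h => Subtype.ext ((hg x).unique h)⟩
    have h' : g x = y := congrArg Subtype.val h
    exact mem_preimage.2 (h' ▸ hg x)
  rw [this]
  exact isCompact_setOf_shiftRel.isClosed.preimage (by fun_prop)

theorem actsOnItineraries_of_shiftRel {f : Dinf → Dinf} (hf : ∀ x : Dinf, ShiftRel x (f x)) :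
    ActsOnItineraries f where
  origin x hx := by
    have h : ShiftRel x 0 := by
      rw [hx]
      simpa [localPt_nil_zero] using ShiftRel.base (r := 0) (by simp)
    exact (hf x).unique h
  base r hr x hx := by
    have h : ShiftRel x 0 := hx ▸ ShiftRel.base (Ioc_subset_Icc_self hr)
    exact (hf x).unique h
  pred n τ r hr x hx := by
    have h : ShiftRel x (itinPt n τ r) :=
      hx ▸ ShiftRel.pred n (localPt_mem_localDendrite τ (Ioc_subset_Icc_self hr))
    exact (hf x).unique h
  drop a m τ r hr x hx := by
    have h : ShiftRel x (itinPt (m + a.level) τ r) :=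
      hx ▸ ShiftRel.drop a m (localPt_mem_localDendrite τ (Ioc_subset_Icc_self hr))
    exact (hf x).unique h

theorem continuous_localPt (τ : List (DyadicPt × ℕ)) : Continuous (localPt τ) := by
  induction τ with
  | nil => exact continuous_localPt_nil
  | cons i τ ih => exact (continuous_attachMap i.1 i.2).comp ih

/-- The parameter `r = 0`, excluded from the prescription, is recovered as a limit along each beam.
-/
theorem dense_itinPt :
    Dense {x : Dinf | ∃ n τ, ∃ r ∈ Ioc (0 : ℝ) 1, (x : Plane) = itinPt n τ r} := by
  rw [Subtype.dense_iff]
  refine closure_minimal (iUnion_subset fun k => iUnion_subset fun n => iUnion₂_subset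
    fun τ _ => ?_) isClosed_closure
  rintro _ ⟨r, hr, rfl⟩
  refine map_mem_closure (s := Ioc (0 : ℝ) 1)
    ((continuous_rootMap n).comp (continuous_localPt τ)) ?_ fun s hs => ?_
  · rwa [closure_Ioc zero_ne_one]
  · exact ⟨⟨_, rootMap_mem_Dinf n (localPt_mem_localDendrite τ (Ioc_subset_Icc_self hs))⟩,
      ⟨n, τ, s, hs, rfl⟩, rfl⟩

theorem ActsOnItineraries.unique {f g : C(Dinf, Dinf)} (hf : ActsOnItineraries f)
    (hg : ActsOnItineraries g) : f = g := by
  refine DFunLike.coe_injective (f.continuous.ext_on dense_itinPt g.continuous ?_)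
  rintro x ⟨n, τ, r, hr, hx⟩
  refine Subtype.ext ?_
  match n, τ with
  | n + 1, τ => rw [hf.pred n τ r hr x hx, hg.pred n τ r hr x hx]
  | 0, [] => rw [hf.base r hr x hx, hg.base r hr x hx]
  | 0, (a, m) :: τ => rw [hf.drop a m τ r hr x hx, hg.drop a m τ r hr x hx]

/-- Extends the rule from finite itineraries to all points, including the infinite itineraries that
produce the limit sets. -/
theorem ActsOnItineraries.shiftRel {f : C(Dinf, Dinf)} (hf : ActsOnItineraries f) (x : Dinf) :
    ShiftRel x (f x) := by
  obtain ⟨g, hg⟩ := exists_continuousMap_shiftRel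
  rw [hf.unique (actsOnItineraries_of_shiftRel hg)]
  exact hg x

/-! ### Orbits -/

/-- The point of the dendrite with position `p` relative to the `n`-th beam at the origin. -/
noncomputable def rootPt (n : ℕ) (p : localDendrite) : Dinf :=
  ⟨rootMap n p, rootMap_mem_Dinf n p.2⟩

/-- `attachMap` as a self-map of `localDendrite`. -/
noncomputable def attachPt (a : DyadicPt) (m : ℕ) (p : localDendrite) : localDendrite :=
  ⟨attachMap a m p, attachMap_mem_localDendrite a m p.2⟩

/-- The point at proportion `t` of the unit segment. -/
noncomputable def segPt (t : Icc (0 : ℝ) 1) : localDendrite :=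
  ⟨localPt [] t, localPt_mem_localDendrite [] t.2⟩

theorem continuous_attachPt (a : DyadicPt) (m : ℕ) : Continuous (attachPt a m) :=
  ((continuous_attachMap a m).comp continuous_subtype_val).subtype_mk _

theorem dist_rootPt_le (n : ℕ) (p q : localDendrite) :
    dist (rootPt n p) (rootPt n q) ≤ 4 * dist p q :=
  dist_rootMap_le_four_mul n p q

theorem dist_segPt_le (s t : Icc (0 : ℝ) 1) : dist (segPt s) (segPt t) ≤ |(s : ℝ) - t| :=
  dist_localPt_nil s t

instance : CompactSpace localDendrite := isCompact_iff_compactSpace.1 isCompact_localDendrite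

instance : Nonempty localDendrite := ⟨⟨0, zero_mem_localDendrite⟩⟩

theorem mem_initialSegments_iff {r : ℝ} (hr : r ≤ 1) {x : Dinf} :
    x ∈ initialSegments r ↔ ∃ j, ∃ t : Icc (0 : ℝ) 1, (t : ℝ) ≤ r ∧ x = rootPt j (segPt t) := by
  constructor
  · rintro ⟨j, t, ht, hx⟩
    exact ⟨j, ⟨t, ht.1, ht.2.trans hr⟩, ht.2, Subtype.ext hx⟩
  · rintro ⟨j, t, ht, rfl⟩
    exact ⟨j, t, ⟨t.2.1, ht⟩, rfl⟩

theorem isClosed_initialSegments {r : ℝ} (h0 : 0 ≤ r) (h1 : r ≤ 1) :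
    IsClosed (initialSegments r) := by
  have hS : IsCompact (⋃ n, rootMap n '' (localPt [] '' Icc 0 r)) := by
    refine isCompact_iUnion_rootMap (isCompact_Icc.image continuous_localPt_nil) ?_
      ⟨0, left_mem_Icc.2 h0, localPt_nil_zero⟩
    rintro _ ⟨t, ht, rfl⟩
    exact localPt_nil_mem_unitTriangle ⟨ht.1, ht.2.trans h1⟩
  convert! hS.isClosed.preimage (continuous_subtype_val (p := fun x => x ∈ Dinf)) using 1
  ext x
  constructor
  · rintro ⟨j, t, ht, hx⟩
    exact mem_iUnion.2 ⟨j, _, ⟨t, ht, rfl⟩, hx.symm⟩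
  · intro hx
    obtain ⟨j, _, ⟨t, ht, rfl⟩, hx⟩ := mem_iUnion.1 hx
    exact ⟨j, t, ht, hx.symm⟩

theorem mem_omegaSet_iff {X : Type*} [TopologicalSpace X] {f : X → X} {x y : X} :
    y ∈ omegaSet f x ↔ MapClusterPt y atTop fun k : ℕ => f^[k] x :=
  mem_omegaLimit_singleton_iff_mapClusterPt _ _ _ _

section dynamics
variable {f : Dinf → Dinf} (hf : ∀ x : Dinf, ShiftRel x (f x))
include hf

theorem apply_rootPt_succ (n : ℕ) (p : localDendrite) :
    f (rootPt (n + 1) p) = rootPt n p :=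
  Subtype.ext ((hf _).unique (.pred n p.2))

theorem apply_rootPt_attachPt (a : DyadicPt) (m : ℕ) (p : localDendrite) :
    f (rootPt 0 (attachPt a m p)) = rootPt (m + a.level) p :=
  Subtype.ext ((hf _).unique (.drop a m p.2))

theorem iterate_rootPt_add (n j : ℕ) (p : localDendrite) :
    f^[n] (rootPt (n + j) p) = rootPt j p := by
  induction n with
  | zero => simp
  | succ n ih =>
    rw [Function.iterate_succ_apply, Nat.add_right_comm, apply_rootPt_succ hf, ih]

variable {a : ℕ → DyadicPt} {p : ℕ → localDendrite}
  (hp : ∀ k, p k = attachPt (a k) k (p (k + 1)))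
include hp

/-- One step drops `a k` and enters the root beam `k + level`; the other `k + level - j` steps
descend to the beam `j`. -/
theorem iterate_rootPt_zero (k j : ℕ) (hj : j ≤ k) :
    f^[k + (a k).level - j + 1] (rootPt 0 (p k)) = rootPt j (p (k + 1)) := by
  rw [Function.iterate_succ_apply, hp k, apply_rootPt_attachPt hf]
  obtain ⟨n, hn⟩ := Nat.exists_eq_add_of_le' (hj.trans (Nat.le_add_right k (a k).level))
  rw [hn, Nat.add_sub_cancel, iterate_rootPt_add hf]

theorem exists_iterate_eq_rootPt_zero (k : ℕ) :
    ∃ T, k ≤ T ∧ f^[T] (rootPt 0 (p 0)) = rootPt 0 (p k) := by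
  induction k with
  | zero => exact ⟨0, le_rfl, rfl⟩
  | succ k ih =>
    obtain ⟨T, hT, h⟩ := ih
    refine ⟨k + (a k).level - 0 + 1 + T, by omega, ?_⟩
    rw [Function.iterate_add_apply, h, iterate_rootPt_zero hf hp k 0 (Nat.zero_le k)]

theorem exists_iterate_eq_rootPt {j k : ℕ} (hj : j ≤ k) :
    ∃ T, k ≤ T ∧ f^[T] (rootPt 0 (p 0)) = rootPt j (p (k + 1)) := by
  obtain ⟨T, hT, h⟩ := exists_iterate_eq_rootPt_zero hf hp k
  refine ⟨k + (a k).level - j + 1 + T, by omega, ?_⟩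
  rw [Function.iterate_add_apply, h, iterate_rootPt_zero hf hp k j hj]

/-- Controls all late times, not only a subsequence: a step either lowers the root beam or passes
from `p i` to `p (i + 1)`. -/
theorem eventually_iterate_eq_rootPt (k : ℕ) :
    ∀ᶠ T in atTop, ∃ i ≥ k, ∃ j, f^[T] (rootPt 0 (p 0)) = rootPt j (p i) := by
  obtain ⟨T₀, -, h⟩ := exists_iterate_eq_rootPt_zero hf hp k
  refine eventually_atTop.2 ⟨T₀, fun T hT => ?_⟩
  induction T, hT using Nat.le_induction with
  | base => exact ⟨k, le_rfl, 0, h⟩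
  | succ T _ ih =>
    obtain ⟨i, hi, j, hij⟩ := ih
    rw [Function.iterate_succ_apply', hij]
    cases j with
    | succ j => exact ⟨i, hi, j, apply_rootPt_succ hf j _⟩
    | zero =>
      refine ⟨i + 1, hi.trans (Nat.le_succ i), i + (a i).level, ?_⟩
      rw [hp i, apply_rootPt_attachPt hf]

omit hf in
theorem dist_backward_orbit_le (k : ℕ) :
    dist (p k) (segPt ⟨(a k).val, (a k).val_mem_Icc⟩) ≤ (1 / 2 : ℝ) ^ k := by
  rw [hp k]
  refine (dist_attachMap_le (a k) k
    (localDendrite_subset_unitTriangle (p (k + 1)).2)).trans ?_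
  exact pow_le_pow_of_le_one (by norm_num) (by norm_num) (Nat.le_add_left k _)

theorem omegaSet_eq_initialSegments {r : ℝ} (hr : r ∈ Ioc (0 : ℝ) 1) (har : ∀ k, (a k).val < r)
    (hfreq : ∀ b : DyadicPt, b.val < r → ∃ᶠ k in atTop, a k = b) :
    omegaSet f (rootPt 0 (p 0)) = initialSegments r := by
  have hsmall : ∀ ε > 0, ∀ᶠ k : ℕ in atTop, 4 * (1 / 2 : ℝ) ^ k < ε := fun ε hε => by
    have h : Tendsto (fun k : ℕ => 4 * (1 / 2 : ℝ) ^ k) atTop (𝓝 0) := by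
      simpa using (tendsto_pow_atTop_nhds_zero_of_lt_one (r := (1 / 2 : ℝ)) (by norm_num)
        (by norm_num)).const_mul 4
    exact h.eventually (gt_mem_nhds hε)
  refine Subset.antisymm (fun y hy => ?_) fun y hy => ?_
  · rw [mem_omegaSet_iff, mapClusterPt_iff_frequently] at hy
    refine (isClosed_initialSegments hr.1.le hr.2).closure_subset (Metric.mem_closure_iff.2 ?_)
    intro ε hε
    obtain ⟨k, hk⟩ := eventually_atTop.1 (hsmall (ε / 2) (half_pos hε))
    obtain ⟨T, hT, i, hi, j, hij⟩ := ((hy _ (Metric.ball_mem_nhds y (half_pos hε))).and_eventually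
      (eventually_iterate_eq_rootPt hf hp k)).exists
    rw [hij, Metric.mem_ball'] at hT
    refine ⟨rootPt j (segPt ⟨(a i).val, (a i).val_mem_Icc⟩),
      (mem_initialSegments_iff hr.2).2 ⟨j, _, (har i).le, rfl⟩, ?_⟩
    have h1 := dist_rootPt_le j (p i) (segPt ⟨(a i).val, (a i).val_mem_Icc⟩)
    have h2 := dist_backward_orbit_le hp i
    have h3 := hk i hi
    have h4 := dist_triangle y (rootPt j (p i)) (rootPt j (segPt ⟨(a i).val, (a i).val_mem_Icc⟩))
    linarith
  · have hdyadic : ∀ (j : ℕ) (b : DyadicPt), b.val < r →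
        rootPt j (segPt ⟨b.val, b.val_mem_Icc⟩) ∈ omegaSet f (rootPt 0 (p 0)) := by
      intro j b hb
      rw [mem_omegaSet_iff, mapClusterPt_iff_frequently]
      intro U hU
      obtain ⟨ε, hε, hεU⟩ := Metric.mem_nhds_iff.1 hU
      refine frequently_atTop.2 fun N => ?_
      obtain ⟨k, hkb, hkε, hk⟩ := ((hfreq b hb).and_eventually
        ((hsmall ε hε).and (eventually_ge_atTop (max N j + 1)))).exists
      -- The tail `p (k + 1)` is guaranteed to visit the root beams `j ≤ k`, so the index with `a (k
      -- + 1) = b` must exceed both `j` and `N`.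
      obtain ⟨k, rfl⟩ := Nat.exists_eq_add_of_le' ((Nat.le_add_left 1 _).trans hk)
      obtain ⟨T, hT, h⟩ := exists_iterate_eq_rootPt hf hp (j := j) (k := k) (by omega)
      refine ⟨T, by omega, hεU ?_⟩
      rw [h, Metric.mem_ball]
      have h1 := dist_rootPt_le j (p (k + 1)) (segPt ⟨b.val, b.val_mem_Icc⟩)
      have h2 := dist_backward_orbit_le hp (k + 1)
      simp only [hkb] at h2
      linarith
    obtain ⟨j, t, ht, rfl⟩ := (mem_initialSegments_iff hr.2).1 hy
    refine (isClosed_omegaLimit _ _ _).closure_subset (Metric.mem_closure_iff.2 ?_)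
    intro ε hε
    -- Only dyadics strictly below `r` occur in the sequence, so `t = r` has to be approached from
    -- the left. The 4 is the Lipschitz constant of the root maps.
    obtain ⟨b, hb, hbt⟩ : ∃ b : DyadicPt, b.val < r ∧ |(t : ℝ) - b.val| < ε / 4 := by
      rcases ht.lt_or_eq with htr | htr
      · obtain ⟨b, hb1, hb2⟩ := DyadicPt.exists_val_mem_Ioo t.2.1
          (lt_min htr (lt_add_of_pos_right (t : ℝ) (by positivity : 0 < ε / 4)))
          ((min_le_left _ _).trans hr.2)
        obtain ⟨hb2, hb3⟩ := lt_min_iff.1 hb2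
        exact ⟨b, hb2, by rw [abs_lt]; constructor <;> linarith⟩
      · obtain ⟨b, hb1, hb2⟩ := DyadicPt.exists_val_mem_Ioo (le_max_left 0 (r - ε / 4))
          (max_lt hr.1 (sub_lt_self r (by positivity))) hr.2
        have := (le_max_right 0 (r - ε / 4)).trans_lt hb1
        exact ⟨b, hb2, by rw [abs_lt]; constructor <;> linarith⟩
    refine ⟨_, hdyadic j b hb, ?_⟩
    have h1 := dist_rootPt_le j (segPt t) (segPt ⟨b.val, b.val_mem_Icc⟩)
    have h2 := dist_segPt_le t ⟨b.val, b.val_mem_Icc⟩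
    dsimp only at h2
    linarith

end dynamics

/-- Composing an enumeration with the first coordinate of `Nat.unpair` repeats each term infinitely
often. -/
theorem exists_dyadic_sequence {r : ℝ} (hr : r ∈ Ioc (0 : ℝ) 1) :
    ∃ a : ℕ → DyadicPt, (∀ k, (a k).val < r) ∧
      ∀ b : DyadicPt, b.val < r → ∃ᶠ k in atTop, a k = b := by
  obtain ⟨c, hc⟩ := DyadicPt.exists_val_mem_Ioo le_rfl hr.1 hr.2
  have : Nonempty {b : DyadicPt // b.val < r} := ⟨⟨c, hc.2⟩⟩
  obtain ⟨e, he⟩ := exists_surjective_nat {b : DyadicPt // b.val < r}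
  refine ⟨fun k => e k.unpair.1, fun k => (e k.unpair.1).2, fun b hb => ?_⟩
  obtain ⟨i, hi⟩ := he ⟨b, hb⟩
  exact frequently_atTop.2 fun N => ⟨Nat.pair i N, Nat.right_le_pair i N, by simp [hi]⟩

theorem exists_omegaSet_eq_initialSegments {f : Dinf → Dinf} (hf : ∀ x : Dinf, ShiftRel x (f x))
    {r : ℝ} (hr : r ∈ Ioc (0 : ℝ) 1) : ∃ x : Dinf, omegaSet f x = initialSegments r := by
  obtain ⟨a, har, hfreq⟩ := exists_dyadic_sequence hr
  obtain ⟨p, hp⟩ := exists_backward_orbit (fun k => attachPt (a k) k)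
    fun k => continuous_attachPt (a k) k
  exact ⟨_, omegaSet_eq_initialSegments hf hp hr har hfreq⟩

/-! ### The arc of omega limit sets -/

theorem omegaSet_of_isFixedPt {X : Type*} [TopologicalSpace X] [T1Space X] {f : X → X} {x : X}
    (hx : Function.IsFixedPt f x) : omegaSet f x = {x} := by
  ext y
  rw [mem_omegaSet_iff, mapClusterPt_iff_frequently, mem_singleton_iff]
  simp only [hx.iterate _ |>.eq, frequently_const]
  constructor
  · intro h
    by_contra hne
    exact h _ (isOpen_compl_singleton.mem_nhds hne) rfl
  · rintro rfl U hU
    exact mem_of_mem_nhds hU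

theorem rootPt_segPt_zero (j : ℕ) : (rootPt j (segPt 0) : Plane) = 0 := by
  change rootMap j (localPt [] 0) = 0
  rw [localPt_nil_zero, rootMap_apply_origin]

theorem initialSegments_zero : initialSegments 0 = {rootPt 0 (segPt 0)} := by
  ext x
  rw [mem_initialSegments_iff zero_le_one, mem_singleton_iff]
  constructor
  · rintro ⟨j, t, ht, rfl⟩
    obtain rfl : t = 0 := Subtype.ext (le_antisymm ht t.2.1)
    exact Subtype.ext ((rootPt_segPt_zero j).trans (rootPt_segPt_zero 0).symm)
  · rintro rfl
    exact ⟨0, 0, le_rfl, rfl⟩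

/-- The point at proportion `r` of the beam 0 is on no other root beam unless it is the origin, so
its proportion can be compared with `s`. -/
theorem le_of_initialSegments_subset {r s : Icc (0 : ℝ) 1}
    (h : initialSegments r ⊆ initialSegments s) : r ≤ s := by
  have hr : rootPt 0 (segPt r) ∈ initialSegments r :=
    (mem_initialSegments_iff r.2.2).2 ⟨0, r, le_rfl, rfl⟩
  obtain ⟨j, t, ht, hrt⟩ := (mem_initialSegments_iff s.2.2).1 (h hr)
  have hrt' : rootMap 0 (localPt [] r) = rootMap j (localPt [] t) := congrArg Subtype.val hrt
  rcases rootMap_eq_rootMap (localPt_nil_mem_unitTriangle r.2)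
    (localPt_nil_mem_unitTriangle t.2) hrt' with ⟨h0, -⟩ | ⟨-, h0⟩
  · have h1 := congrArg (fun z : Plane => z 0) h0
    simp only [localPt_nil_apply_zero, PiLp.zero_apply] at h1
    exact Subtype.coe_le_coe.1 (h1.trans_le s.2.1)
  · have h1 := congrArg (fun z : Plane => z 0) h0
    simp only [localPt_nil_apply_zero] at h1
    exact Subtype.coe_le_coe.1 (h1.trans_le ht)

/-- The sets `initialSegments r` as points of the hyperspace. -/
noncomputable def segmentArc (r : unitInterval) : NonemptyCompacts Dinf :=
  ⟨⟨initialSegments r, (isClosed_initialSegments r.2.1 r.2.2).isCompact⟩,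
    ⟨rootPt 0 (segPt 0), (mem_initialSegments_iff r.2.2).2 ⟨0, 0, r.2.1, rfl⟩⟩⟩

theorem coe_segmentArc (r : unitInterval) : (segmentArc r : Set Dinf) = initialSegments r := rfl

theorem continuous_segmentArc : Continuous segmentArc := by
  refine (LipschitzWith.of_dist_le_mul (K := 4) fun r s => ?_).continuous
  have key : ∀ r s : unitInterval, ∀ x ∈ initialSegments r, ∃ y ∈ initialSegments s,
      dist x y ≤ 4 * dist r s := by
    intro r s x hx
    obtain ⟨j, t, ht, rfl⟩ := (mem_initialSegments_iff r.2.2).1 hx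
    -- Retract along the same beam to proportion `s`; this moves the parameter by at most `|r - s|`,
    -- whatever the beam.
    refine ⟨rootPt j (segPt (min t s)), (mem_initialSegments_iff s.2.2).2
      ⟨j, _, min_le_right t s, rfl⟩, (dist_rootPt_le j _ _).trans ?_⟩
    gcongr
    refine (dist_segPt_le _ _).trans ?_
    rw [Subtype.dist_eq, Real.dist_eq]
    rcases le_total t s with h | h
    · rw [min_eq_left h, sub_self, abs_zero]
      exact abs_nonneg _
    · rw [min_eq_right h, abs_of_nonneg (sub_nonneg.2 (Subtype.coe_le_coe.2 h))]
      exact (sub_le_sub_right ht _).trans (le_abs_self _)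
  rw [Metric.NonemptyCompacts.dist_eq]
  refine Metric.hausdorffDist_le_of_mem_dist (by positivity) (key r s) fun x hx => ?_
  rw [dist_comm r s]
  exact key s r x hx

theorem injective_segmentArc : Function.Injective segmentArc := fun r s h => by
  have h' : initialSegments r = initialSegments s := by
    rw [← coe_segmentArc, ← coe_segmentArc, h]
  exact le_antisymm (le_of_initialSegments_subset h'.subset)
    (le_of_initialSegments_subset h'.superset)

theorem isEmbedding_segmentArc : IsEmbedding segmentArc :=
  (continuous_segmentArc.isClosedEmbedding injective_segmentArc).isEmbedding

theorem segmentArc_mem_omegaHyperspace {f : Dinf → Dinf} (hf : ∀ x : Dinf, ShiftRel x (f x))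
    (r : unitInterval) : segmentArc r ∈ omegaHyperspace f := by
  rcases r.2.1.lt_or_eq with hr | hr
  · obtain ⟨x, hx⟩ := exists_omegaSet_eq_initialSegments hf ⟨hr, r.2.2⟩
    exact ⟨x, hx.symm⟩
  · refine ⟨rootPt 0 (segPt 0), ?_⟩
    have hfix : f (rootPt 0 (segPt 0)) = rootPt 0 (segPt 0) :=
      Subtype.ext (((actsOnItineraries_of_shiftRel hf).origin _ (rootPt_segPt_zero 0)).trans
        (rootPt_segPt_zero 0).symm)
    rw [omegaSet_of_isFixedPt hfix, coe_segmentArc, ← hr, initialSegments_zero]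

theorem not_totallyDisconnectedSpace_omegaHyperspace {f : Dinf → Dinf}
    (hf : ∀ x : Dinf, ShiftRel x (f x)) : ¬ TotallyDisconnectedSpace (omegaHyperspace f) := by
  intro _
  have hcont : Continuous fun r : unitInterval =>
      (⟨segmentArc r, segmentArc_mem_omegaHyperspace hf r⟩ : omegaHyperspace f) :=
    continuous_segmentArc.subtype_mk _
  have h := (isPreconnected_range hcont).subsingleton ⟨0, rfl⟩ ⟨1, rfl⟩
  exact zero_ne_one (injective_segmentArc (congrArg Subtype.val h))

theorem mainTheorem6 :
    (∃! f : C(Dinf, Dinf), ActsOnItineraries f) ∧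
    ∀ f : C(Dinf, Dinf), ActsOnItineraries f →
      (∀ r ∈ Ioc (0 : ℝ) 1, ∃ x : Dinf, omegaSet f x = initialSegments r) ∧
      (∃ φ : unitInterval → NonemptyCompacts Dinf,
        (∀ r : unitInterval, (φ r : Set Dinf) = initialSegments r) ∧
        IsEmbedding φ ∧
        range φ ⊆ omegaHyperspace f) ∧
      ¬ TotallyDisconnectedSpace (omegaHyperspace f) ∧
      ¬ TotallySeparatedSpace (omegaHyperspace f) := by
  obtain ⟨g, hg⟩ := exists_continuousMap_shiftRel
  refine ⟨⟨g, actsOnItineraries_of_shiftRel hg,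
    fun f hf => hf.unique (actsOnItineraries_of_shiftRel hg)⟩, fun f hf => ?_⟩
  have hS : ∀ x : Dinf, ShiftRel x (f x) := hf.shiftRel
  refine ⟨fun r hr => exists_omegaSet_eq_initialSegments hS hr,
    ⟨segmentArc, coe_segmentArc, isEmbedding_segmentArc, ?_⟩,
    not_totallyDisconnectedSpace_omegaHyperspace hS,
    fun _ => not_totallyDisconnectedSpace_omegaHyperspace hS inferInstance⟩
  rintro _ ⟨r, rfl⟩
  exact segmentArc_mem_omegaHyperspace hS r
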